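/- Let $R$ be a ring with identity. Chain complexes are $\mathbb{Z}$-indexed with differentials lowering the degree. A chain complex $X$ of left (or right) $R$-modules is finitely generated if, whenever $X=\sum_{i\in I}S_i$ for subcomplexes $S_i$, there is a finite $J\subseteq I$ with $X=\sum_{i\in J}S_i$; it is of type $FP_\infty$ if it has a projective resolution $\cdots\to P_1\to P_0\to X\to 0$ by finitely generated projective complexes. A complex $A$ is absolutely clean if $\mathrm{Ext}^1(X,A)=0$, computed in the category of chain complexes, for all complexes $X$ of type $FP_\infty$ (on the same side as $A$). For a complex $X$ of right modules and a complex $Y$ of left modules, let $X\otimes Y$ be the usual tensor product complex over $R$, with differential $d(x\otimes y)=dx\otimes y+(-1)^{|x|}x\otimes dy$, and let $X\,\overline{\otimes}\,Y$ be the complex of abelian groups with degree $n$ term $(X\otimes Y)_n/B_n(X\otimes Y)$ and differential $\overline{x\otimes y}\mapsto\overline{dx\otimes y}$. Let $\overline{\mathrm{Tor}}_i$ denote the left derived functors of $\overline{\otimes}$. A complex $L$ of left (resp. right) modules is level if $\overline{\mathrm{Tor}}_1(X,L)=0$ (resp. $\overline{\mathrm{Tor}}_1(L,X)=0$) for all complexes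 $X$ of right (resp. left) modules of type $FP_\infty$. For a complex $L$ of left (resp. right) $R$-modules, its character complex $L^+=\mathrm{Hom}_{\mathbb{Z}}(L,\mathbb{Q}/\mathbb{Z})$ is the complex of right (resp. left) $R$-modules with $(L^+)_n=\mathrm{Hom}_{\mathbb{Z}}(L_{-n},\mathbb{Q}/\mathbb{Z})$ and differentials given by precomposition with those of $L$. Then: 1. A chain complex $L$ of left (resp. right) $R$-modules is level if and only if $L^+$ is an absolutely clean complex of right (resp. left) $R$-modules. 2. A chain complex $A$ of left (resp. right) $R$-modules is absolutely clean if and only if $A^+$ is a level complex of right (resp. left) $R$-modules. -/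

import Mathlib

open CategoryTheory CategoryTheory.Limits

universe u

noncomputable section

namespace ACComplex

section Tensor

variable (R : Type u) [Ring R]

/-- The subgroup of `M ⊗_ℤ N` generated by the elements `(m r) ⊗ n - m ⊗ (r n)`, for a right
`R`-module `M` and a left `R`-module `N`. Right `R`-modules are modules over `Rᵐᵒᵖ`. -/
def balancedSubgroup (M N : Type u) [AddCommGroup M] [AddCommGroup N] [Module Rᵐᵒᵖ M]
    [Module R N] : AddSubgroup (TensorProduct ℤ M N) :=
  AddSubgroup.closure
    {z | ∃ (m : M) (r : R) (n : N),
      z = TensorProduct.tmul ℤ (MulOpposite.op r • m) n - TensorProduct.tmul ℤ m (r • n)}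

/-- The abelian group `M ⊗_R N` for a right `R`-module `M` and a left `R`-module `N`. -/
def Tens (M N : Type u) [AddCommGroup M] [AddCommGroup N] [Module Rᵐᵒᵖ M]
    [Module R N] : Type u :=
  TensorProduct ℤ M N ⧸ balancedSubgroup R M N

section

variable {M M' M'' N N' N'' : Type u}
  [AddCommGroup M] [AddCommGroup M'] [AddCommGroup M'']
  [AddCommGroup N] [AddCommGroup N'] [AddCommGroup N'']
  [Module Rᵐᵒᵖ M] [Module Rᵐᵒᵖ M'] [Module Rᵐᵒᵖ M'']
  [Module R N] [Module R N'] [Module R N'']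

instance : AddCommGroup (Tens R M N) :=
  inferInstanceAs (AddCommGroup (TensorProduct ℤ M N ⧸ balancedSubgroup R M N))

/-- The class of `m ⊗ n` in `M ⊗_R N`. -/
def tmul (m : M) (n : N) : Tens R M N :=
  QuotientAddGroup.mk' (balancedSubgroup R M N) (TensorProduct.tmul ℤ m n)

lemma tens_hom_ext {A : Type u} [AddCommGroup A] {f g : Tens R M N →+ A}
    (h : ∀ m n, f (tmul R m n) = g (tmul R m n)) : f = g := by
  have key : f.comp (QuotientAddGroup.mk' (balancedSubgroup R M N)) =
      g.comp (QuotientAddGroup.mk' (balancedSubgroup R M N)) := by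
    ext x
    induction x using TensorProduct.induction_on with
    | zero => rw [map_zero, map_zero]
    | tmul m n => exact h m n
    | add x y hx hy => rw [map_add, map_add, hx, hy]
  ext x
  obtain ⟨y, rfl⟩ := QuotientAddGroup.mk'_surjective (balancedSubgroup R M N) x
  exact DFunLike.congr_fun key y

/-- The homomorphism `f ⊗ g : M ⊗_R N → M' ⊗_R N'`. -/
def tensMap (f : M →ₗ[Rᵐᵒᵖ] M') (g : N →ₗ[R] N') : Tens R M N →+ Tens R M' N' :=
  QuotientAddGroup.map _ _
    (TensorProduct.map f.toAddMonoidHom.toIntLinearMap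
      g.toAddMonoidHom.toIntLinearMap).toAddMonoidHom (by
    rw [balancedSubgroup, AddSubgroup.closure_le]
    rintro _ ⟨m, r, n, rfl⟩
    refine AddSubgroup.subset_closure ⟨f m, r, g n, ?_⟩
    simp)

lemma tensMap_tmul (f : M →ₗ[Rᵐᵒᵖ] M') (g : N →ₗ[R] N') (m : M) (n : N) :
    tensMap R f g (tmul R m n) = tmul R (f m) (g n) := rfl

lemma tmul_add_left (m m' : M) (n : N) : tmul R (m + m') n = tmul R m n + tmul R m' n := by
  simp only [tmul, TensorProduct.add_tmul, map_add]
  rfl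

lemma tmul_add_right (m : M) (n n' : N) : tmul R m (n + n') = tmul R m n + tmul R m n' := by
  simp only [tmul, TensorProduct.tmul_add, map_add]
  rfl

lemma tensMap_id : tensMap R (LinearMap.id : M →ₗ[Rᵐᵒᵖ] M) (LinearMap.id : N →ₗ[R] N) =
    AddMonoidHom.id _ :=
  tens_hom_ext R fun _ _ => rfl

lemma tensMap_comp (f : M →ₗ[Rᵐᵒᵖ] M') (f' : M' →ₗ[Rᵐᵒᵖ] M'') (g : N →ₗ[R] N')
    (g' : N' →ₗ[R] N'') :
    tensMap R (f'.comp f) (g'.comp g) = (tensMap R f' g').comp (tensMap R f g) :=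
  tens_hom_ext R fun _ _ => rfl

lemma tensMap_add_left (f f' : M →ₗ[Rᵐᵒᵖ] M') (g : N →ₗ[R] N') :
    tensMap R (f + f') g = tensMap R f g + tensMap R f' g :=
  tens_hom_ext R fun m n => by
    simp only [AddMonoidHom.add_apply, tensMap_tmul, LinearMap.add_apply, tmul_add_left]

lemma tensMap_add_right (f : M →ₗ[Rᵐᵒᵖ] M') (g g' : N →ₗ[R] N') :
    tensMap R f (g + g') = tensMap R f g + tensMap R f g' :=
  tens_hom_ext R fun m n => by
    simp only [AddMonoidHom.add_apply, tensMap_tmul, LinearMap.add_apply, tmul_add_right]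

end

/-- The bifunctor `(M, N) ↦ M ⊗_R N` from right and left `R`-modules to abelian groups. -/
def tensFunctor : ModuleCat.{u} Rᵐᵒᵖ ⥤ ModuleCat.{u} R ⥤ AddCommGrpCat.{u} where
  obj M :=
    { obj := fun N => AddCommGrpCat.of (Tens R M N)
      map := fun g => AddCommGrpCat.ofHom (tensMap R LinearMap.id g.hom)
      map_id := fun _ => AddCommGrpCat.hom_ext (tensMap_id R)
      map_comp := fun g g' => AddCommGrpCat.hom_ext
        (tensMap_comp R LinearMap.id LinearMap.id g.hom g'.hom) }
  map f :=
    { app := fun _ => AddCommGrpCat.ofHom (tensMap R f.hom LinearMap.id)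
      naturality := fun _ _ g => AddCommGrpCat.hom_ext
        ((tensMap_comp R LinearMap.id f.hom g.hom LinearMap.id).symm.trans
          (tensMap_comp R f.hom LinearMap.id LinearMap.id g.hom)) }
  map_id _ := NatTrans.ext (funext fun _ => AddCommGrpCat.hom_ext (tensMap_id R))
  map_comp f f' := NatTrans.ext (funext fun _ => AddCommGrpCat.hom_ext
    (tensMap_comp R f.hom f'.hom LinearMap.id LinearMap.id))

instance : (tensFunctor R).Additive where
  map_add {_ _ f f'} := NatTrans.ext (funext fun _ => AddCommGrpCat.hom_ext
    (tensMap_add_left R f.hom f'.hom LinearMap.id))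

instance (M : ModuleCat.{u} Rᵐᵒᵖ) : ((tensFunctor R).obj M).Additive where
  map_add {_ _ g g'} := AddCommGrpCat.hom_ext (tensMap_add_right R LinearMap.id g.hom g'.hom)

end Tensor

/-- Chain complexes of left `S`-modules, indexed by `ℤ`, with differentials lowering the degree.
Chain complexes of right `R`-modules are `Ch Rᵐᵒᵖ`. -/
abbrev Ch (S : Type u) [Ring S] := ChainComplex (ModuleCat.{u} S) ℤ

/-- The usual sign `(-1)^p` in the differential of a total complex of chain complexes. -/
instance tensorSignsDown : ComplexShape.TensorSigns (ComplexShape.down ℤ) where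
  ε' := MonoidHom.mk' (fun p => Int.negOnePow (Multiplicative.toAdd p))
    (fun p q => Int.negOnePow_add _ _)
  rel_add p q r (hpq : q + 1 = p) := show (q + r) + 1 = p + r by lia
  add_rel p q r (hpq : q + 1 = p) := show (r + q) + 1 = r + p by lia
  ε'_succ p q hpq := by
    obtain rfl : q + 1 = p := hpq
    change q.negOnePow = - (q + 1).negOnePow
    rw [Int.negOnePow_succ, neg_neg]

section TensorComplex

variable (R : Type u) [Ring R]

/-- The usual tensor product `X ⊗ Y` of a complex of right modules and a complex of left modules:
`(X ⊗ Y)_n = ⨁_{p + q = n} X_p ⊗_R Y_q` and `d (x ⊗ y) = dx ⊗ y + (-1)^p x ⊗ dy`. -/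
abbrev tensorCx (X : Ch.{u} Rᵐᵒᵖ) (Y : Ch.{u} R) : ChainComplex AddCommGrpCat.{u} ℤ :=
  HomologicalComplex.mapBifunctor X Y (tensFunctor R) (ComplexShape.down ℤ)

/-- The part `x ⊗ y ↦ dx ⊗ y` of the differential of `X ⊗ Y`. -/
abbrev tensorD₁ (X : Ch.{u} Rᵐᵒᵖ) (Y : Ch.{u} R) (i j : ℤ) :
    (tensorCx R X Y).X i ⟶ (tensorCx R X Y).X j :=
  HomologicalComplex.mapBifunctor.D₁ X Y (tensFunctor R) (ComplexShape.down ℤ) i j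

lemma d_tensorD₁ (X : Ch.{u} Rᵐᵒᵖ) (Y : Ch.{u} R) (i j k : ℤ) :
    (tensorCx R X Y).d i j ≫ tensorD₁ R X Y j k =
      - (tensorD₁ R X Y i j ≫ (tensorCx R X Y).d j k) := by
  rw [HomologicalComplex.mapBifunctor.d_eq, HomologicalComplex.mapBifunctor.d_eq,
    Preadditive.add_comp, Preadditive.comp_add]
  simp only [tensorD₁, HomologicalComplex.mapBifunctor.D₁, HomologicalComplex.mapBifunctor.D₂]
  rw [HomologicalComplex₂.D₁_D₁, HomologicalComplex₂.D₂_D₁, zero_add, zero_add]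

/-- The modified tensor product of complexes: in degree `n` it is
`(X ⊗ Y)_n / B_n(X ⊗ Y)` (the cokernel of the differential `(X ⊗ Y)_{n+1} → (X ⊗ Y)_n`), and its
differential is induced by `x ⊗ y ↦ dx ⊗ y`. -/
def tensorBar (X : Ch.{u} Rᵐᵒᵖ) (Y : Ch.{u} R) : ChainComplex AddCommGrpCat.{u} ℤ where
  X n := (tensorCx R X Y).opcycles n
  d i j := (tensorCx R X Y).descOpcycles (tensorD₁ R X Y i j ≫ (tensorCx R X Y).pOpcycles j)
    _ rfl (by
      rw [← Category.assoc, d_tensorD₁, Preadditive.neg_comp, Category.assoc,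
        HomologicalComplex.d_pOpcycles, comp_zero, neg_zero])
  shape i j hij := by
    rw [← cancel_epi ((tensorCx R X Y).pOpcycles i), HomologicalComplex.p_descOpcycles,
      tensorD₁, HomologicalComplex.mapBifunctor.D₁, HomologicalComplex₂.D₁_shape _ _ _ _ hij,
      zero_comp, comp_zero]
  d_comp_d' i j k _ _ := by
    rw [← cancel_epi ((tensorCx R X Y).pOpcycles i), HomologicalComplex.p_descOpcycles_assoc,
      Category.assoc, HomologicalComplex.p_descOpcycles, ← Category.assoc,
      tensorD₁, tensorD₁, HomologicalComplex.mapBifunctor.D₁, HomologicalComplex.mapBifunctor.D₁,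
      HomologicalComplex₂.D₁_D₁, zero_comp, comp_zero]

/-- The chain map `X ⊗ Y → X' ⊗ Y'` induced by two chain maps. -/
abbrev tensorCxMap {X X' : Ch.{u} Rᵐᵒᵖ} {Y Y' : Ch.{u} R} (f : X ⟶ X') (g : Y ⟶ Y') :
    tensorCx R X Y ⟶ tensorCx R X' Y' :=
  HomologicalComplex.mapBifunctorMap f g (tensFunctor R) (ComplexShape.down ℤ)

lemma tensorCxMap_D₁ {X X' : Ch.{u} Rᵐᵒᵖ} {Y Y' : Ch.{u} R} (f : X ⟶ X') (g : Y ⟶ Y')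
    (i j : ℤ) : (tensorCxMap R f g).f i ≫ tensorD₁ R X' Y' i j =
      tensorD₁ R X Y i j ≫ (tensorCxMap R f g).f j :=
  HomologicalComplex₂.total.mapAux.mapMap_D₁ _ _ _ _

lemma tensorCxMap_id (X : Ch.{u} Rᵐᵒᵖ) (Y : Ch.{u} R) :
    tensorCxMap R (𝟙 X) (𝟙 Y) = 𝟙 _ := by
  ext1 n
  apply HomologicalComplex.mapBifunctor.hom_ext
  intro i₁ i₂ h
  rw [HomologicalComplex.ι_mapBifunctorMap]
  simp

lemma tensorCxMap_comp {X X' X'' : Ch.{u} Rᵐᵒᵖ} {Y Y' Y'' : Ch.{u} R} (f : X ⟶ X')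
    (f' : X' ⟶ X'') (g : Y ⟶ Y') (g' : Y' ⟶ Y'') :
    tensorCxMap R (f ≫ f') (g ≫ g') = tensorCxMap R f g ≫ tensorCxMap R f' g' := by
  ext1 n
  apply HomologicalComplex.mapBifunctor.hom_ext
  intro i₁ i₂ h
  rw [HomologicalComplex.comp_f, HomologicalComplex.ι_mapBifunctorMap_assoc,
    HomologicalComplex.ι_mapBifunctorMap, HomologicalComplex.ι_mapBifunctorMap]
  simp

lemma tensorCxMap_add_left {X X' : Ch.{u} Rᵐᵒᵖ} {Y Y' : Ch.{u} R} (f f' : X ⟶ X')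
    (g : Y ⟶ Y') :
    tensorCxMap R (f + f') g = tensorCxMap R f g + tensorCxMap R f' g := by
  ext1 n
  apply HomologicalComplex.mapBifunctor.hom_ext
  intro i₁ i₂ h
  rw [HomologicalComplex.add_f_apply, Preadditive.comp_add]
  simp only [HomologicalComplex.ι_mapBifunctorMap]
  simp [Functor.map_add]

lemma tensorCxMap_add_right {X X' : Ch.{u} Rᵐᵒᵖ} {Y Y' : Ch.{u} R} (f : X ⟶ X')
    (g g' : Y ⟶ Y') :
    tensorCxMap R f (g + g') = tensorCxMap R f g + tensorCxMap R f g' := by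
  ext1 n
  apply HomologicalComplex.mapBifunctor.hom_ext
  intro i₁ i₂ h
  rw [HomologicalComplex.add_f_apply, Preadditive.comp_add]
  simp only [HomologicalComplex.ι_mapBifunctorMap]
  simp [Functor.map_add]

/-- Functoriality of the modified tensor product. -/
def tensorBarMap {X X' : Ch.{u} Rᵐᵒᵖ} {Y Y' : Ch.{u} R} (f : X ⟶ X') (g : Y ⟶ Y') :
    tensorBar R X Y ⟶ tensorBar R X' Y' where
  f n := HomologicalComplex.opcyclesMap (tensorCxMap R f g) n
  comm' i j _ := by
    dsimp only [tensorBar]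
    rw [← cancel_epi ((tensorCx R X Y).pOpcycles i), HomologicalComplex.p_opcyclesMap_assoc,
      HomologicalComplex.p_descOpcycles, HomologicalComplex.p_descOpcycles_assoc,
      ← Category.assoc, tensorCxMap_D₁, Category.assoc, Category.assoc,
      HomologicalComplex.p_opcyclesMap]

/-- The functor `- ⊗̄ Y` on complexes of right modules. -/
def tensorBarLeft (Y : Ch.{u} R) : Ch.{u} Rᵐᵒᵖ ⥤ ChainComplex AddCommGrpCat.{u} ℤ where
  obj X := tensorBar R X Y
  map f := tensorBarMap R f (𝟙 Y)
  map_id X := by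
    ext1 n
    exact (congrArg (fun φ => HomologicalComplex.opcyclesMap φ n) (tensorCxMap_id R X Y)).trans
      (HomologicalComplex.opcyclesMap_id _ _)
  map_comp f f' := by
    ext1 n
    refine Eq.trans ?_ (HomologicalComplex.opcyclesMap_comp _ _ _)
    rw [← tensorCxMap_comp, Category.comp_id]
    rfl

/-- The functor `X ⊗̄ -` on complexes of left modules. -/
def tensorBarRight (X : Ch.{u} Rᵐᵒᵖ) : Ch.{u} R ⥤ ChainComplex AddCommGrpCat.{u} ℤ where
  obj Y := tensorBar R X Y
  map g := tensorBarMap R (𝟙 X) g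
  map_id Y := by
    ext1 n
    exact (congrArg (fun φ => HomologicalComplex.opcyclesMap φ n) (tensorCxMap_id R X Y)).trans
      (HomologicalComplex.opcyclesMap_id _ _)
  map_comp g g' := by
    ext1 n
    refine Eq.trans ?_ (HomologicalComplex.opcyclesMap_comp _ _ _)
    rw [← tensorCxMap_comp, Category.comp_id]
    rfl

instance (Y : Ch.{u} R) : (tensorBarLeft R Y).Additive where
  map_add {X X' f f'} := by
    ext1 n
    rw [HomologicalComplex.add_f_apply]
    change HomologicalComplex.opcyclesMap (tensorCxMap R (f + f') (𝟙 Y)) n =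
      HomologicalComplex.opcyclesMap (tensorCxMap R f (𝟙 Y)) n +
        HomologicalComplex.opcyclesMap (tensorCxMap R f' (𝟙 Y)) n
    rw [tensorCxMap_add_left, ← cancel_epi ((tensorCx R X Y).pOpcycles n), Preadditive.comp_add]
    simp only [HomologicalComplex.p_opcyclesMap, HomologicalComplex.add_f_apply,
      Preadditive.add_comp]

instance (X : Ch.{u} Rᵐᵒᵖ) : (tensorBarRight R X).Additive where
  map_add {Y Y' g g'} := by
    ext1 n
    rw [HomologicalComplex.add_f_apply]
    change HomologicalComplex.opcyclesMap (tensorCxMap R (𝟙 X) (g + g')) n =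
      HomologicalComplex.opcyclesMap (tensorCxMap R (𝟙 X) g) n +
        HomologicalComplex.opcyclesMap (tensorCxMap R (𝟙 X) g') n
    rw [tensorCxMap_add_right, ← cancel_epi ((tensorCx R X Y).pOpcycles n), Preadditive.comp_add]
    simp only [HomologicalComplex.p_opcyclesMap, HomologicalComplex.add_f_apply,
      Preadditive.add_comp]

end TensorComplex

/-- Every complex of modules is a quotient of a projective complex (a direct sum of disks on
projective modules). -/
instance enoughProjectivesCh (S : Type u) [Ring S] : EnoughProjectives (Ch.{u} S) where
  presentation X := by
    let P (i : ℤ) : Ch.{u} S := HomologicalComplex.evalCompCoyonedaCorepresentative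
      (ComplexShape.down ℤ) (Projective.over (X.X i)) i
    let e (i : ℤ) := HomologicalComplex.evalCompCoyonedaCorepresentable
      (ComplexShape.down ℤ) (Projective.over (X.X i)) i
    have hP (i : ℤ) : Projective (P i) := ⟨fun {E Y} f g _ => by
      have hg : Epi (g.f i) :=
        inferInstanceAs (Epi ((HomologicalComplex.eval _ (ComplexShape.down ℤ) i).map g))
      let f' : Projective.over (X.X i) ⟶ Y.X i := (e i).homEquiv f
      obtain ⟨k, hk⟩ := Projective.factors f' (g.f i)
      refine ⟨(e i).homEquiv.symm k, (e i).homEquiv.injective ?_⟩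
      refine ((e i).homEquiv_comp _ _).trans (Eq.trans ?_ hk)
      exact congrArg (fun l : Projective.over (X.X i) ⟶ E.X i => l ≫ g.f i)
        ((e i).homEquiv.apply_symm_apply k)⟩
    have hsum : Projective (∐ P) := ⟨fun {E Y} f g _ =>
      ⟨Sigma.desc fun i => (hP i).factors (Sigma.ι P i ≫ f) g |>.choose,
        Sigma.hom_ext _ _ fun i => by
          rw [Sigma.ι_desc_assoc]
          exact ((hP i).factors (Sigma.ι P i ≫ f) g).choose_spec⟩⟩
    let φ : (∐ P) ⟶ X := Sigma.desc fun i => (e i).homEquiv.symm (Projective.π (X.X i))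
    have hφ (i : ℤ) : Epi (φ.f i) := by
      have h1 : Projective.π (X.X i) = (e i).homEquiv (Sigma.ι P i) ≫ φ.f i := by
        have := (e i).homEquiv_comp φ (Sigma.ι P i)
        rw [Sigma.ι_desc] at this
        exact ((e i).homEquiv.apply_symm_apply _).symm.trans this
      exact epi_of_epi_fac h1.symm
    exact ⟨{ p := ∐ P, projective := hsum, f := φ
             epi := HomologicalComplex.epi_of_epi_f _ hφ }⟩

instance hasExtCh (S : Type u) [Ring S] : HasExt.{u} (Ch.{u} S) :=
  hasExt_of_enoughProjectives _

/-- `Tor̄_i(X, Y)`: the left derived functors of the modified tensor product, obtained by deriving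
in the variable `X` of complexes of right modules. -/
def torBar (R : Type u) [Ring R] (i : ℕ) (X : Ch.{u} Rᵐᵒᵖ) (Y : Ch.{u} R) :
    ChainComplex AddCommGrpCat.{u} ℤ :=
  ((tensorBarLeft R Y).leftDerived i).obj X

/-- `Tor̄_i(X, Y)`: the left derived functors of the modified tensor product, obtained by deriving
in the variable `Y` of complexes of left modules. -/
def torBar' (R : Type u) [Ring R] (i : ℕ) (X : Ch.{u} Rᵐᵒᵖ) (Y : Ch.{u} R) :
    ChainComplex AddCommGrpCat.{u} ℤ :=
  ((tensorBarRight R X).leftDerived i).obj Y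

section Classes

variable {S : Type u} [Ring S]

/-- A subcomplex: submodules `S_n ≤ X_n` with `d S_n ≤ S_{n-1}`. -/
structure Subcx (X : Ch.{u} S) where
  carrier : ∀ n : ℤ, Submodule S (X.X n)
  map_d : ∀ (i j : ℤ), (carrier i).map (X.d i j).hom ≤ carrier j

/-- `X` is finitely generated: whenever `X` is the sum of a family of subcomplexes, it is the sum
of a finite subfamily. -/
def IsFG (X : Ch.{u} S) : Prop :=
  ∀ (ι : Type u) (T : ι → Subcx X), (∀ n, ⨆ i, (T i).carrier n = ⊤) →
    ∃ J : Finset ι, ∀ n, ⨆ i ∈ J, (T i).carrier n = ⊤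

/-- `X` is of type `FP_∞`: it has a projective resolution by finitely generated projective
complexes. -/
def IsFPInfty (X : Ch.{u} S) : Prop :=
  ∃ P : ProjectiveResolution X, ∀ n, IsFG (P.complex.X n)

/-- `A` is absolutely clean: `Ext¹(X, A) = 0` for all complexes `X` of type `FP_∞`. -/
def IsAbsClean (A : Ch.{u} S) : Prop :=
  ∀ X : Ch.{u} S, IsFPInfty X → Subsingleton (Abelian.Ext.{u} X A 1)

end Classes

section Level

variable {R : Type u} [Ring R]

/-- A complex `L` of left `R`-modules is level: `Tor̄_1(X, L) = 0` for all complexes `X` of right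
`R`-modules of type `FP_∞`. -/
def IsLevelLeft (L : Ch.{u} R) : Prop :=
  ∀ X : Ch.{u} Rᵐᵒᵖ, IsFPInfty X → IsZero (torBar R 1 X L)

/-- A complex `L` of right `R`-modules is level: `Tor̄_1(L, X) = 0` for all complexes `X` of left
`R`-modules of type `FP_∞`. -/
def IsLevelRight (L : Ch.{u} Rᵐᵒᵖ) : Prop :=
  ∀ X : Ch.{u} R, IsFPInfty X → IsZero (torBar' R 1 L X)

end Level

section Character

variable (R : Type u) [Ring R]

/-- The right `R`-module structure `(f r)(n) = f (r n)` on `Hom_ℤ(N, ℚ/ℤ)`, `N` a left module. -/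
abbrev charRightModule (N : Type u) [AddCommGroup N] [Module R N] :
    Module Rᵐᵒᵖ (CharacterModule N) where
  smul r f := AddMonoidHom.comp (f : N →+ AddCircle (1 : ℚ)) (DistribSMul.toAddMonoidHom N r.unop)
  one_smul f := CharacterModule.ext _ fun n => congrArg f (one_smul R n)
  mul_smul r s f := CharacterModule.ext _ fun n => congrArg f (mul_smul s.unop r.unop n)
  smul_zero _ := rfl
  smul_add _ _ _ := rfl
  add_smul r s f := CharacterModule.ext _ fun n =>
    (congrArg f (add_smul r.unop s.unop n)).trans (map_add f _ _)
  zero_smul f := CharacterModule.ext _ fun n => (congrArg f (zero_smul R n)).trans (map_zero f)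

/-- The left `R`-module structure `(r f)(m) = f (m r)` on `Hom_ℤ(M, ℚ/ℤ)`, `M` a right module. -/
abbrev charLeftModule (M : Type u) [AddCommGroup M] [Module Rᵐᵒᵖ M] :
    Module R (CharacterModule M) where
  smul r f := AddMonoidHom.comp (f : M →+ AddCircle (1 : ℚ))
    (DistribSMul.toAddMonoidHom M (MulOpposite.op r))
  one_smul f := CharacterModule.ext _ fun m => congrArg f (one_smul Rᵐᵒᵖ m)
  mul_smul r s f := CharacterModule.ext _ fun m =>
    congrArg f (mul_smul (MulOpposite.op s) (MulOpposite.op r) m)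
  smul_zero _ := rfl
  smul_add _ _ _ := rfl
  add_smul r s f := CharacterModule.ext _ fun m =>
    (congrArg f (add_smul (MulOpposite.op r) (MulOpposite.op s) m)).trans (map_add f _ _)
  zero_smul f := CharacterModule.ext _ fun m => (congrArg f (zero_smul Rᵐᵒᵖ m)).trans (map_zero f)

/-- The contravariant functor `N ↦ N^+ = Hom_ℤ(N, ℚ/ℤ)` from left to right modules. -/
def charOfLeft : (ModuleCat.{u} R)ᵒᵖ ⥤ ModuleCat.{u} Rᵐᵒᵖ where
  obj N := @ModuleCat.of Rᵐᵒᵖ _ (CharacterModule N.unop) _ (charRightModule R N.unop)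
  map {N N'} g :=
    letI := charRightModule R N.unop
    letI := charRightModule R N'.unop
    ModuleCat.ofHom
      { toFun := fun f : CharacterModule N.unop =>
          (AddMonoidHom.comp (f : N.unop →+ AddCircle (1 : ℚ)) g.unop.hom.toAddMonoidHom :
            CharacterModule N'.unop)
        map_add' := fun _ _ => rfl
        map_smul' := fun r f => CharacterModule.ext _ fun n =>
          congrArg f (map_smul g.unop.hom r.unop n).symm }
  map_id _ := rfl
  map_comp _ _ := rfl

/-- The contravariant functor `M ↦ M^+ = Hom_ℤ(M, ℚ/ℤ)` from right to left modules. -/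
def charOfRight : (ModuleCat.{u} Rᵐᵒᵖ)ᵒᵖ ⥤ ModuleCat.{u} R where
  obj M := @ModuleCat.of R _ (CharacterModule M.unop) _ (charLeftModule R M.unop)
  map {M M'} g :=
    letI := charLeftModule R M.unop
    letI := charLeftModule R M'.unop
    ModuleCat.ofHom
      { toFun := fun f : CharacterModule M.unop =>
          (AddMonoidHom.comp (f : M.unop →+ AddCircle (1 : ℚ)) g.unop.hom.toAddMonoidHom :
            CharacterModule M'.unop)
        map_add' := fun _ _ => rfl
        map_smul' := fun r f => CharacterModule.ext _ fun m =>
          congrArg f (map_smul g.unop.hom (MulOpposite.op r) m).symm }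
  map_id _ := rfl
  map_comp _ _ := rfl

instance : (charOfLeft R).Additive where
  map_add {_ _ g g'} := ModuleCat.hom_ext (LinearMap.ext fun (f : CharacterModule _) =>
    CharacterModule.ext _ fun n => map_add f (g.unop.hom n) (g'.unop.hom n))

instance : (charOfRight R).Additive where
  map_add {_ _ g g'} := ModuleCat.hom_ext (LinearMap.ext fun (f : CharacterModule _) =>
    CharacterModule.ext _ fun m => map_add f (g.unop.hom m) (g'.unop.hom m))

variable {R}

/-- The character complex `L^+ = Hom_ℤ(L, ℚ/ℤ)` of a complex of left modules, a complex of right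
modules: `(L^+)_n = (L_{-n})^+`, with differentials the transposes of those of `L`. -/
def charCxOfLeft (L : Ch.{u} R) : Ch.{u} Rᵐᵒᵖ where
  X n := (charOfLeft R).obj (Opposite.op (L.X (-n)))
  d i j := (charOfLeft R).map (L.d (-j) (-i)).op
  shape i j hij := by
    rw [L.shape _ _ fun h : -i + 1 = -j => hij (show j + 1 = i by lia), op_zero,
      Functor.map_zero]
  d_comp_d' i j k _ _ := by
    rw [← Functor.map_comp, ← op_comp, L.d_comp_d, op_zero, Functor.map_zero]

/-- The character complex `L^+ = Hom_ℤ(L, ℚ/ℤ)` of a complex of right modules, a complex of left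
modules: `(L^+)_n = (L_{-n})^+`, with differentials the transposes of those of `L`. -/
def charCxOfRight (L : Ch.{u} Rᵐᵒᵖ) : Ch.{u} R where
  X n := (charOfRight R).obj (Opposite.op (L.X (-n)))
  d i j := (charOfRight R).map (L.d (-j) (-i)).op
  shape i j hij := by
    rw [L.shape _ _ fun h : -i + 1 = -j => hij (show j + 1 = i by lia), op_zero,
      Functor.map_zero]
  d_comp_d' i j k _ _ := by
    rw [← Functor.map_comp, ← op_comp, L.d_comp_d, op_zero, Functor.map_zero]

end Character

end ACComplex

end

/-! Maps from the disc with generator in degree `n` to the translate of `A` by `m` form `A_{n-m}`,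
and the degree `m` term of the modified tensor product of this disc with `L` is `L_{m-n}`. If `A` is
the character complex of `L`, or conversely, one of these groups is the character dual of the other.
A finite dual basis extends this duality, naturally, from discs to all finitely generated projective
complexes.

Apply it to the terms `P₂ → P₁ → P₀` of a resolution of `X`. Since ℚ/ℤ is an injective cogenerator,
a sequence is exact exactly when its character dual is (`exact_iff_exact_of_perfect`). Hence the
degree `m` part of the first derived functor vanishes at `X` exactly when `Ext¹` from `X` to the
translate of `A` by `m` does. Type `FP_∞` is stable under translation, hence so is absolute
cleanness, and one translate of `A` speaks for all of them.

`BarTensor` treats tensoring on either side uniformly, so `BarTensor.forall_isZero_leftDerived_iff`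
gives all four equivalences: in the first statement Hom is the dual of the tensor product, in the
second the tensor product is the dual of Hom. Only degreewise exactness enters, so the differential
of the modified tensor product plays no role. -/

namespace ACComplex

/-! ### Character duality preserves and reflects exactness. -/

section Duality

/-- ℚ/ℤ is a cogenerator: some character of `U ⧸ K` is nonzero on the class of `u`. -/
lemma exists_character_of_notMem {U : Type*} [AddCommGroup U] (K : AddSubgroup U) {u : U}
    (hu : u ∉ K) : ∃ χ : U →+ AddCircle (1 : ℚ), (∀ k ∈ K, χ k = 0) ∧ χ u ≠ 0 := by
  obtain ⟨χ, hχ⟩ := CharacterModule.exists_character_apply_ne_zero_of_ne_zero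
    (a := QuotientAddGroup.mk' K u) (fun h => hu ((QuotientAddGroup.eq_zero_iff u).1 h))
  refine ⟨AddMonoidHom.comp (χ : U ⧸ K →+ AddCircle (1 : ℚ)) (QuotientAddGroup.mk' K),
    fun k hk => ?_, hχ⟩
  have h : QuotientAddGroup.mk' K k = 0 := (QuotientAddGroup.eq_zero_iff k).2 hk
  exact (congrArg χ h).trans (map_zero χ)

/-- ℚ/ℤ is injective: `χ` descends to `U ⧸ ker g`, which embeds in `W`. -/
lemma exists_character_comp_eq {U W : Type*} [AddCommGroup U] [AddCommGroup W] (g : U →+ W)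
    (χ : U →+ AddCircle (1 : ℚ)) (hχ : ∀ u, g u = 0 → χ u = 0) :
    ∃ χ' : W →+ AddCircle (1 : ℚ), ∀ u, χ' (g u) = χ u := by
  obtain ⟨c, hc⟩ := CharacterModule.dual_surjective_of_injective
    (QuotientAddGroup.kerLift g).toIntLinearMap (QuotientAddGroup.kerLift_injective g)
    (QuotientAddGroup.lift g.ker χ fun u hu => hχ u hu)
  exact ⟨c, fun u => DFunLike.congr_fun hc (QuotientAddGroup.mk u)⟩

/-- If `V₀ → V₁ → V₂` is identified with the character dual of `U₂ → U₁ → U₀`, then one sequence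
is exact if and only if the other one is. -/
lemma exact_iff_exact_of_perfect {U₀ U₁ U₂ V₀ V₁ V₂ : Type*} [AddCommGroup U₀] [AddCommGroup U₁]
    [AddCommGroup U₂] [AddCommGroup V₀] [AddCommGroup V₁] [AddCommGroup V₂]
    {f : U₂ →+ U₁} {g : U₁ →+ U₀} {g' : V₀ →+ V₁} {f' : V₁ →+ V₂}
    {b₀ : V₀ →+ U₀ →+ AddCircle (1 : ℚ)} {b₁ : V₁ →+ U₁ →+ AddCircle (1 : ℚ)}
    {b₂ : V₂ →+ U₂ →+ AddCircle (1 : ℚ)} (h₀ : Function.Bijective b₀)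
    (h₁ : Function.Bijective b₁) (h₂ : Function.Bijective b₂)
    (hg : ∀ v u, b₁ (g' v) u = b₀ v (g u)) (hf : ∀ v u, b₂ (f' v) u = b₁ v (f u)) :
    Function.Exact f g ↔ Function.Exact g' f' := by
  constructor
  · intro hU v
    constructor
    · intro hv
      -- As `f' v = 0`, the character `b₁ v` kills the image of `f`, which is the kernel of `g`.
      obtain ⟨χ, hχ⟩ := exists_character_comp_eq g (b₁ v) fun u hu => by
        obtain ⟨w, rfl⟩ := (hU u).1 hu
        rw [← hf, hv, map_zero, AddMonoidHom.zero_apply]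
      obtain ⟨w, rfl⟩ := h₀.2 χ
      exact ⟨w, h₁.1 (AddMonoidHom.ext fun u => (hg w u).trans (hχ u))⟩
    · rintro ⟨w, rfl⟩
      refine h₂.1 (AddMonoidHom.ext fun u => ?_)
      rw [hf, hg, (hU (f u)).2 ⟨u, rfl⟩, map_zero, map_zero, AddMonoidHom.zero_apply]
  · intro hV u
    constructor
    · intro hu
      by_contra hne
      -- A character killing the image of `f` comes from the kernel of `f'`, hence from `V₀`, and so
      -- vanishes wherever `g` does, in particular at `u`.
      obtain ⟨χ, hχ, hχu⟩ := exists_character_of_notMem f.range hne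
      obtain ⟨v, rfl⟩ := h₁.2 χ
      have hv : f' v = 0 := h₂.1 (AddMonoidHom.ext fun w => by
        rw [hf, hχ _ ⟨w, rfl⟩, map_zero, AddMonoidHom.zero_apply])
      obtain ⟨w, rfl⟩ := (hV v).1 hv
      exact hχu (by rw [hg, hu, map_zero])
    · rintro ⟨w, rfl⟩
      refine CharacterModule.eq_zero_of_character_apply fun χ => ?_
      obtain ⟨v, hv⟩ := h₀.2 χ
      have : χ (g (f w)) = b₀ v (g (f w)) := by rw [hv]; rfl
      rw [this, ← hg, ← hf, (hV _).2 ⟨v, rfl⟩, map_zero, AddMonoidHom.zero_apply]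

end Duality

/-! ### `Ext¹` and the first left derived functor read off a resolution. -/

section Criteria

/-- The map `Hom(Y, A) → Hom(X, A)` of precomposition with `f`. -/
def precomp {C : Type*} [Category* C] [Preadditive C] {X Y : C} (f : X ⟶ Y) (A : C) :
    (Y ⟶ A) →+ (X ⟶ A) :=
  AddMonoidHom.mk' (fun g => f ≫ g) fun _ _ => Preadditive.comp_add _ _ _ _ _ _

/-- Extension classes are represented by cocycles `P₁ ⟶ A`, and a cocycle is trivial exactly when it
factors through `P₁ ⟶ P₀`. -/
lemma subsingleton_ext_one_iff {C : Type*} [Category* C] [Abelian C] [HasExt.{u} C] {X : C}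
    (P : ProjectiveResolution X) (A : C) :
    Subsingleton (Abelian.Ext.{u} X A 1) ↔
      Function.Exact (precomp (P.complex.d 1 0) A) (precomp (P.complex.d 2 1) A) := by
  constructor
  · intro h f
    constructor
    · intro hf
      exact (P.extMk_eq_zero_iff f 2 rfl hf 0 rfl).1 (Subsingleton.elim _ _)
    · rintro ⟨g, rfl⟩
      change P.complex.d 2 1 ≫ P.complex.d 1 0 ≫ g = 0
      rw [← Category.assoc, P.complex.d_comp_d, zero_comp]
  · intro h
    refine subsingleton_of_forall_eq 0 fun α => ?_
    obtain ⟨f, hf, rfl⟩ := P.extMk_surjective α 2 rfl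
    exact (P.extMk_eq_zero_iff f 2 rfl hf 0 rfl).2 ((h f).1 hf)

lemma isZero_leftDerived_one_iff {C : Type*} [Category* C] [Abelian C] [EnoughProjectives C]
    (F : C ⥤ ChainComplex AddCommGrpCat.{u} ℤ) [F.Additive] {X : C}
    (P : ProjectiveResolution X) :
    IsZero ((F.leftDerived 1).obj X) ↔ ∀ m : ℤ,
      Function.Exact ((F.map (P.complex.d 2 1)).f m).hom ((F.map (P.complex.d 1 0)).f m).hom := by
  rw [(P.isoLeftDerivedObj F 1).isZero_iff]
  change IsZero (((F.mapHomologicalComplex _).obj P.complex).homology 1) ↔ _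
  rw [← HomologicalComplex.exactAt_iff_isZero_homology,
    HomologicalComplex.exactAt_iff' _ 2 1 0 (by simp) (by simp),
    HomologicalComplex.exact_iff_degreewise_exact]
  exact forall_congr' fun m => ShortComplex.ab_exact_iff_function_exact _

end Criteria

/-! ### Translation invariance of type `FP_∞` and of absolute cleanness. -/

section Shift

variable {S : Type u} [Ring S]

/-- The translate of complexes with `(shiftCh k X)_p = X_{p - k}`, without change of signs. -/
def shiftCh (k : ℤ) : Ch.{u} S ⥤ Ch.{u} S where
  obj X :=
    { X := fun p => X.X (p - k)
      d := fun p q => X.d (p - k) (q - k)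
      shape := fun p q h => X.shape _ _ fun h' : q - k + 1 = p - k => h (show q + 1 = p by lia)
      d_comp_d' := fun _ _ _ _ _ => X.d_comp_d _ _ _ }
  map f := { f := fun p => f.f (p - k), comm' := fun _ _ _ => f.comm _ _ }

instance (k : ℤ) : (shiftCh (S := S) k).Additive where

/-- Translating forth and back is the identity. -/
def shiftChCompIso (k l : ℤ) (h : k + l = 0) : shiftCh (S := S) k ⋙ shiftCh l ≅ 𝟭 _ :=
  NatIso.ofComponents
    (fun X => HomologicalComplex.Hom.isoOfComponents
      (fun p => X.XIsoOfEq (show p - l - k = p by lia))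
      (fun p q _ => by
        change (X.XIsoOfEq _).hom ≫ X.d p q = X.d (p - l - k) (q - l - k) ≫ (X.XIsoOfEq _).hom
        simp))
    (fun {X Y} f => by
      ext1 p
      have hp : p - l - k = p := by lia
      change f.f (p - l - k) ≫ (Y.XIsoOfEq hp).hom = (X.XIsoOfEq hp).hom ≫ f.f p
      exact HomologicalComplex.XIsoOfEq_hom_naturality f hp)

/-- Translation is an equivalence of categories. -/
def shiftChEquiv (k : ℤ) : Ch.{u} S ≌ Ch.{u} S :=
  CategoryTheory.Equivalence.mk (shiftCh k) (shiftCh (-k))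
    (shiftChCompIso k (-k) (by lia)).symm (shiftChCompIso (-k) k (by lia))

instance (k : ℤ) : (shiftCh (S := S) k).IsEquivalence :=
  (shiftChEquiv k).isEquivalence_functor

/-- Transport of a submodule along an equality of degrees. -/
def castSubmodule (X : Ch.{u} S) {p q : ℤ} (h : p = q) (K : Submodule S (X.X p)) :
    Submodule S (X.X q) := h ▸ K

lemma castSubmodule_iSup (X : Ch.{u} S) {p q : ℤ} (h : p = q) {ι : Sort*}
    (K : ι → Submodule S (X.X p)) :
    ⨆ i, castSubmodule X h (K i) = castSubmodule X h (⨆ i, K i) := by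
  subst h; rfl

lemma castSubmodule_eq_top (X : Ch.{u} S) {p q : ℤ} (h : p = q) {K : Submodule S (X.X p)} :
    castSubmodule X h K = ⊤ ↔ K = ⊤ := by
  subst h; rfl

lemma castSubmodule_map_d (X : Ch.{u} S) {p q p' q' : ℤ} (h : p = q) (h' : p' = q')
    {K : Submodule S (X.X p)} {K' : Submodule S (X.X p')}
    (hK : K.map (X.d p p').hom ≤ K') :
    (castSubmodule X h K).map (X.d q q').hom ≤ castSubmodule X h' K' := by
  subst h h'; exact hK

/-- The subcomplex of `X` corresponding to a subcomplex of a translate of `X`. -/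
def Subcx.unshift {X : Ch.{u} S} {k : ℤ} (T : Subcx ((shiftCh k).obj X)) : Subcx X where
  carrier n := castSubmodule X (show n + k - k = n by lia) (T.carrier (n + k))
  map_d p q := castSubmodule_map_d X _ _ (T.map_d (p + k) (q + k))

lemma Subcx.iSup_unshift_eq_top {X : Ch.{u} S} {k : ℤ} {ι : Type*}
    (T : ι → Subcx ((shiftCh k).obj X)) (n : ℤ) :
    ⨆ i, (T i).unshift.carrier n = ⊤ ↔ ⨆ i, (T i).carrier (n + k) = ⊤ := by
  unfold Subcx.unshift
  dsimp only
  erw [castSubmodule_iSup, castSubmodule_eq_top]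
  rfl

/-- Subcomplexes of a translate are translates of subcomplexes, with the same sums. -/
lemma IsFG.shiftCh {X : Ch.{u} S} (hX : IsFG X) (k : ℤ) : IsFG ((shiftCh k).obj X) := by
  intro ι T hT
  obtain ⟨J, hJ⟩ := hX ι (fun i => (T i).unshift)
    (fun n => (Subcx.iSup_unshift_eq_top T n).2 (hT (n + k)))
  refine ⟨J, fun p => ?_⟩
  obtain ⟨n, rfl⟩ : ∃ n, p = n + k := ⟨p - k, by lia⟩
  have := hJ n
  rw [iSup_subtype'] at this ⊢
  exact (Subcx.iSup_unshift_eq_top (fun i : J => T i) n).1 this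

/-- The image of a projective resolution under an equivalence of abelian categories. -/
noncomputable def _root_.CategoryTheory.ProjectiveResolution.mapOfIsEquivalence
    {C D : Type*} [Category* C] [Category* D] [Abelian C] [Abelian D] {X : C}
    (P : ProjectiveResolution X) (F : C ⥤ D) [F.Additive] [F.IsEquivalence] :
    ProjectiveResolution (F.obj X) where
  complex := (F.mapHomologicalComplex _).obj P.complex
  projective n := inferInstanceAs (Projective (F.obj (P.complex.X n)))
  π := (F.mapHomologicalComplex _).map P.π ≫
    (HomologicalComplex.singleMapHomologicalComplex F (ComplexShape.down ℕ) 0).hom.app X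
  quasiIso := inferInstance

lemma IsFPInfty.shiftCh {X : Ch.{u} S} (hX : IsFPInfty X) (k : ℤ) :
    IsFPInfty ((shiftCh k).obj X) := by
  obtain ⟨P, hP⟩ := hX
  exact ⟨P.mapOfIsEquivalence (ACComplex.shiftCh k), fun n => (hP n).shiftCh k⟩

lemma IsAbsClean.of_iso {A B : Ch.{u} S} (hA : IsAbsClean A) (e : A ≅ B) : IsAbsClean B := by
  intro X hX
  have := hA X hX
  exact @Equiv.subsingleton _ _
    ((Abelian.extFunctorObj X 1).mapIso e.symm).addCommGroupIsoToAddEquiv.toEquiv this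

/-- Translating both arguments back by `k` embeds the `Ext¹` group into one with second argument
isomorphic to `A` and first argument still of type `FP_∞`. -/
lemma IsAbsClean.shiftCh {A : Ch.{u} S} (hA : IsAbsClean A) (k : ℤ) :
    IsAbsClean ((shiftCh k).obj A) := by
  intro X hX
  have : Subsingleton (Abelian.Ext.{u} _ ((ACComplex.shiftCh (-k)).obj _) 1) :=
    hA.of_iso ((shiftChCompIso k (-k) (by lia)).app A).symm _ (hX.shiftCh (-k))
  exact ((ACComplex.shiftCh (-k)).mapExt_bijective_of_preservesProjectiveObjects X
    ((ACComplex.shiftCh k).obj A) 1).1.subsingleton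

lemma IsAbsClean.of_shiftCh {A : Ch.{u} S} (k : ℤ)
    (hA : IsAbsClean ((ACComplex.shiftCh k).obj A)) : IsAbsClean A :=
  (hA.shiftCh (-k)).of_iso ((shiftChCompIso k (-k) (by lia)).app A)

end Shift

/-! ### Discs and finite dual bases of finitely generated projective complexes. -/

section Disc

variable {S : Type u} [Ring S]

variable (S) in
/-- The disc on the free module of rank one, with generator in degree `n`. -/
noncomputable def disc (n : ℤ) : Ch.{u} S :=
  HomologicalComplex.evalCompCoyonedaCorepresentative (ComplexShape.down ℤ) (ModuleCat.of S S) n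

/-- Morphisms `disc S n ⟶ X` correspond to elements of `X_n`. -/
noncomputable def discHomEquiv (n : ℤ) (X : Ch.{u} S) :
    (disc S n ⟶ X) ≃ (ModuleCat.of S S ⟶ X.X n) :=
  (HomologicalComplex.evalCompCoyonedaCorepresentable
    (ComplexShape.down ℤ) (ModuleCat.of S S) n).homEquiv

variable (S) in
/-- The generator of the disc. -/
noncomputable def discGen (n : ℤ) : (disc S n).X n :=
  (discHomEquiv n (disc S n) (𝟙 _)).hom (1 : S)

lemma discHomEquiv_apply {n : ℤ} {X : Ch.{u} S} (f : disc S n ⟶ X) :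
    (discHomEquiv n X f).hom (1 : S) = (f.f n).hom (discGen S n) := by
  have h : discHomEquiv n X (𝟙 _ ≫ f) = discHomEquiv n _ (𝟙 _) ≫ f.f n :=
    (HomologicalComplex.evalCompCoyonedaCorepresentable
      (ComplexShape.down ℤ) (ModuleCat.of S S) n).homEquiv_comp f (𝟙 _)
  rw [Category.id_comp] at h
  rw [h]
  rfl

/-- Evaluation at the generator identifies `Hom(disc S n, X)` with `X_n`. -/
noncomputable def discEquiv (n : ℤ) (X : Ch.{u} S) : (disc S n ⟶ X) ≃+ X.X n :=
  AddEquiv.mk' (Equiv.ofBijective (fun f => (f.f n).hom (discGen S n)) (by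
    constructor
    · intro f g h
      apply (discHomEquiv n X).injective
      apply ModuleCat.hom_ext
      apply LinearMap.ext_ring
      exact (discHomEquiv_apply f).trans (h.trans (discHomEquiv_apply g).symm)
    · intro x
      refine ⟨(discHomEquiv n X).symm (ModuleCat.ofHom (LinearMap.toSpanSingleton S _ x)), ?_⟩
      beta_reduce
      rw [← discHomEquiv_apply, Equiv.apply_symm_apply]
      exact one_smul S x)) fun _ _ => rfl

lemma exists_disc_hom {n : ℤ} {X : Ch.{u} S} (x : X.X n) :
    ∃ f : disc S n ⟶ X, (f.f n).hom (discGen S n) = x :=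
  (discEquiv n X).surjective x

/-- A subcomplex, as a complex. -/
def Subcx.toCh {X : Ch.{u} S} (T : Subcx X) : Ch.{u} S where
  X n := ModuleCat.of S (T.carrier n)
  d i j := ModuleCat.ofHom ((X.d i j).hom.restrict fun x hx => T.map_d i j ⟨x, hx, rfl⟩)
  shape i j h := by
    refine ModuleCat.hom_ext (LinearMap.ext fun (x : T.carrier i) => Subtype.ext ?_)
    exact congrArg (fun f => f.hom (x : X.X i)) (X.shape i j h)
  d_comp_d' i j k _ _ := by
    refine ModuleCat.hom_ext (LinearMap.ext fun (x : T.carrier i) => Subtype.ext ?_)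
    exact congrArg (fun f => f.hom (x : X.X i)) (X.d_comp_d i j k)

/-- The inclusion of a subcomplex. -/
def Subcx.incl {X : Ch.{u} S} (T : Subcx X) : T.toCh ⟶ X where
  f n := ModuleCat.ofHom (T.carrier n).subtype
  comm' _ _ _ := rfl

/-- The disc maps to `T` by sending the generator to itself; followed by the inclusion, this is the
identity, since it fixes the generator. -/
lemma Subcx.eq_top_of_discGen_mem {n : ℤ} (T : Subcx (disc S n))
    (h : discGen S n ∈ T.carrier n) (p : ℤ) : T.carrier p = ⊤ := by
  obtain ⟨f, hf⟩ := exists_disc_hom (X := T.toCh) (n := n) ⟨discGen S n, h⟩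
  have hid : f ≫ T.incl = 𝟙 _ := (discEquiv n _).injective (congrArg (T.carrier n).subtype hf)
  refine eq_top_iff.2 fun x _ => ?_
  have hx : ((f.f p).hom x : T.carrier p).1 = x :=
    congrArg (fun g : disc S n ⟶ disc S n => (g.f p).hom x) hid
  rw [← hx]
  exact ((f.f p).hom x : T.carrier p).2

/-- The range of a morphism of complexes. -/
def Subcx.range {X Y : Ch.{u} S} (f : X ⟶ Y) : Subcx Y where
  carrier n := LinearMap.range (f.f n).hom
  map_d i j := by
    rintro _ ⟨_, ⟨x, rfl⟩, rfl⟩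
    exact ⟨(X.d i j).hom x, congrArg (fun g => g.hom x) (f.comm i j).symm⟩

/-- The assumption `hb` makes `⨁ D ⟶ P` an epimorphism, which splits because `P` is projective; the
components of a section are the `a j`. -/
lemma exists_sum_comp_eq_id {C : Type*} [Category* C] [Abelian C] {P : C} [Projective P]
    {J : Type*} [Fintype J] {D : J → C} (b : ∀ j, D j ⟶ P)
    (hb : ∀ {Z : C} (f g : P ⟶ Z), (∀ j, b j ≫ f = b j ≫ g) → f = g) :
    ∃ a : ∀ j, P ⟶ D j, ∑ j, a j ≫ b j = 𝟙 P := by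
  have : HasFiniteBiproducts C := Abelian.hasFiniteBiproducts
  have : Epi (biproduct.desc b) := ⟨fun f g h => hb f g fun j => by
    rw [← biproduct.ι_desc b j, Category.assoc, h, Category.assoc]⟩
  obtain ⟨s, hs⟩ := Projective.factors (𝟙 P) (biproduct.desc b)
  refine ⟨fun j => s ≫ biproduct.π _ j, ?_⟩
  have htot : ∑ j, biproduct.π D j ≫ biproduct.ι D j = 𝟙 (⨁ D) :=
    IsBilimit.total (biproduct.isBilimit D)
  have h := congrArg (fun f => s ≫ f ≫ biproduct.desc b) htot
  simpa only [Preadditive.sum_comp, Preadditive.comp_sum, Category.assoc, biproduct.ι_desc,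
    Category.id_comp, hs] using h

/-- A finitely generated projective complex has a finite dual basis. -/
lemma IsFG.exists_dualBasis {P : Ch.{u} S} (hP : IsFG P) [Projective P] :
    ∃ (J : Type u) (_ : Fintype J) (n : J → ℤ) (a : ∀ j, P ⟶ disc S (n j))
      (b : ∀ j, disc S (n j) ⟶ P), ∑ j, a j ≫ b j = 𝟙 P := by
  -- One disc for each homogeneous element: their images cover `P`, and finite generation keeps
  -- finitely many of them.
  choose b hb using fun i : Σ n, P.X n => exists_disc_hom (X := P) i.2
  obtain ⟨J, hJ⟩ := hP (Σ n, P.X n) (fun i => Subcx.range (b i)) fun n => by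
    refine eq_top_iff.2 fun x _ => ?_
    exact Submodule.mem_iSup_of_mem (p := fun i => (Subcx.range (b i)).carrier n) ⟨n, x⟩
      ⟨discGen S n, hb ⟨n, x⟩⟩
  obtain ⟨a, ha⟩ := exists_sum_comp_eq_id (fun j : J => b j) fun f g hfg => by
    ext1 n
    refine ModuleCat.hom_ext (LinearMap.eqLocus_eq_top.1 (eq_top_iff.2 ?_))
    rw [← hJ n]
    refine iSup₂_le fun i hi => ?_
    rintro _ ⟨x, rfl⟩
    exact congrArg (fun h => (h.f n).hom x) (hfg ⟨i, hi⟩)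
  exact ⟨J, inferInstance, fun j => j.1.1, a, fun j => b j, ha⟩

end Disc

/-! ### The perfect pairing between Hom and the modified tensor product. -/

section Perfect

variable {S T : Type u} [Ring S] [Ring T] {σ : S → T}

/-- A pairing `A_p × L_q → ℚ/ℤ`, `p + q = 0`, of complexes, compatible with scalars along
`σ : S → T` and with the differentials. -/
structure CharPairing (σ : S → T) (A : Ch.{u} S) (L : Ch.{u} T) where
  ev {p q : ℤ} (h : p + q = 0) : A.X p →+ L.X q →+ AddCircle (1 : ℚ)
  ev_smul {p q : ℤ} (h : p + q = 0) (s : S) (a : A.X p) (l : L.X q) :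
    ev h (s • a) l = ev h a (σ s • l)
  ev_d {p p' q q' : ℤ} (h : p' + q = 0) (h' : p + q' = 0) (hp : p' + 1 = p) (a : A.X p)
    (l : L.X q) : ev h ((A.d p p').hom a) l = ev h' a ((L.d q q').hom l)

/-- A presentation of the values of a functor `F` by generators `x ⊗ l`, up to signs those of the
modified tensor product with `L`: `x ⊗ l` is biadditive, balanced along `σ`, and
`d x ⊗ l = x ⊗ d l`. -/
structure BarTensor (σ : S → T) (F : Ch.{u} S ⥤ ChainComplex AddCommGrpCat.{u} ℤ)
    (L : Ch.{u} T) where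
  tm (X : Ch.{u} S) {p q m : ℤ} (h : p + q = m) : X.X p →+ L.X q →+ (F.obj X).X m
  map_tm {X X' : Ch.{u} S} (f : X ⟶ X') {p q m : ℤ} (h : p + q = m) (x : X.X p) (l : L.X q) :
    ((F.map f).f m).hom (tm X h x l) = tm X' h ((f.f p).hom x) l
  tm_smul (X : Ch.{u} S) {p q m : ℤ} (h : p + q = m) (s : S) (x : X.X p) (l : L.X q) :
    tm X h (s • x) l = tm X h x (σ s • l)
  tm_d (X : Ch.{u} S) {p p' q q' m : ℤ} (h : p' + q = m) (h' : p + q' = m) (hp : p' + 1 = p)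
    (x : X.X p) (l : L.X q) : tm X h ((X.d p p').hom x) l = tm X h' x ((L.d q q').hom l)
  lift (X : Ch.{u} S) {m : ℤ}
    (β : ∀ {p q : ℤ}, p + q = m → (X.X p →+ L.X q →+ AddCircle (1 : ℚ)))
    (hs : ∀ {p q : ℤ} (h : p + q = m) (s : S) (x : X.X p) (l : L.X q),
      β h (s • x) l = β h x (σ s • l))
    (hd : ∀ {p p' q q' : ℤ} (h : p' + q = m) (h' : p + q' = m) (_ : p' + 1 = p)
      (x : X.X p) (l : L.X q), β h ((X.d p p').hom x) l = β h' x ((L.d q q').hom l)) :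
    ∃ χ : (F.obj X).X m →+ AddCircle (1 : ℚ), ∀ {p q : ℤ} (h : p + q = m) (x : X.X p) (l : L.X q),
      χ (tm X h x l) = β h x l
  span (X : Ch.{u} S) {m : ℤ} (K : AddSubgroup ((F.obj X).X m))
    (hK : ∀ {p q : ℤ} (h : p + q = m) (x : X.X p) (l : L.X q), tm X h x l ∈ K) : K = ⊤

namespace BarTensor

variable {F : Ch.{u} S ⥤ ChainComplex AddCommGrpCat.{u} ℤ} {A : Ch.{u} S} {L : Ch.{u} T}
  (t : BarTensor σ F L) (c : CharPairing σ A L)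

lemma hom_ext {X : Ch.{u} S} {m : ℤ} {χ χ' : (F.obj X).X m →+ AddCircle (1 : ℚ)}
    (H : ∀ {p q : ℤ} (h : p + q = m) (x : X.X p) (l : L.X q),
      χ (t.tm X h x l) = χ' (t.tm X h x l)) : χ = χ' := by
  have := t.span X (χ.eqLocus χ') H
  exact AddMonoidHom.ext fun z => (this ▸ AddSubgroup.mem_top z : z ∈ χ.eqLocus χ')

/-- The form sending `x ⊗ l` to the pairing of `g x` with `l` respects the relations of `BarTensor`:
`g` is linear and commutes with the differentials. -/
lemma exists_pair (X : Ch.{u} S) {m : ℤ} (g : X ⟶ (shiftCh m).obj A) :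
    ∃ χ : (F.obj X).X m →+ AddCircle (1 : ℚ), ∀ {p q : ℤ} (h : p + q = m) (x : X.X p) (l : L.X q),
      χ (t.tm X h x l) = c.ev (p := p - m) (by lia) ((g.f p).hom x) l := by
  refine t.lift X (fun {p q} h => (c.ev (p := p - m) (q := q) (by lia)).comp
    (g.f p).hom.toAddMonoidHom) ?_ ?_
  · intro p q h s x l
    exact (congrArg (fun a => c.ev _ a l) (map_smul (g.f p).hom s x)).trans (c.ev_smul _ s _ l)
  · intro p p' q q' h h' hp x l
    exact (congrArg (fun f => c.ev _ (f.hom x) l) (g.comm p p').symm).trans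
      (c.ev_d _ _ (by lia) _ l)

/-- The pairing `Hom(X, A) × F(X) → ℚ/ℤ` (with translates of `A`) induced by a pairing of `A`
and `L`. -/
noncomputable def pair (X : Ch.{u} S) (m : ℤ) :
    (X ⟶ (shiftCh m).obj A) →+ (F.obj X).X m →+ AddCircle (1 : ℚ) :=
  AddMonoidHom.mk' (fun g => (t.exists_pair c X g).choose) fun g g' => t.hom_ext fun h x l => by
    rw [AddMonoidHom.add_apply, (t.exists_pair c X _).choose_spec,
      (t.exists_pair c X _).choose_spec, (t.exists_pair c X _).choose_spec]
    exact congrArg (fun f => f l) (map_add (c.ev _) _ _)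

lemma pair_tm {X : Ch.{u} S} {m : ℤ} (g : X ⟶ (shiftCh m).obj A) {p q : ℤ} (h : p + q = m)
    (x : X.X p) (l : L.X q) :
    t.pair c X m g (t.tm X h x l) = c.ev (p := p - m) (by lia) ((g.f p).hom x) l :=
  (t.exists_pair c X g).choose_spec h x l

/-- Naturality: precomposition with `f` and `F.map f` are adjoint, as the duality of exact sequences
requires. -/
lemma pair_comp {X X' : Ch.{u} S} {m : ℤ} (f : X ⟶ X') (g : X' ⟶ (shiftCh m).obj A)
    (z : (F.obj X).X m) :
    t.pair c X m (f ≫ g) z = t.pair c X' m g (((F.map f).f m).hom z) := by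
  have : t.pair c X m (f ≫ g) = (t.pair c X' m g).comp ((F.map f).f m).hom :=
    t.hom_ext fun h x l => by
      rw [AddMonoidHom.comp_apply, t.map_tm, t.pair_tm, t.pair_tm]
      rfl
  rw [this]
  rfl

/-- Scalars and differentials can be moved from the disc to `L`. So the `x` all of whose symbols `x
⊗ l` have the form "generator ⊗ `l'`" make up a subcomplex, and it contains the generator. -/
lemma tm_discGen_surjective (n : ℤ) {q m : ℤ} (h : n + q = m) (z : (F.obj (disc S n)).X m) :
    ∃ l : L.X q, t.tm (disc S n) h (discGen S n) l = z := by
  let K := (t.tm (disc S n) h (discGen S n)).range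
  let C : Subcx (disc S n) :=
    { carrier := fun p =>
        { carrier := {x | ∀ {q : ℤ} (h : p + q = m) (l : L.X q), t.tm (disc S n) h x l ∈ K}
          add_mem' := fun hx hy q h l => by
            rw [map_add]
            exact add_mem (hx h l) (hy h l)
          zero_mem' := fun h l => by
            rw [map_zero]
            exact zero_mem K
          smul_mem' := fun s x hx q h l => by
            rw [t.tm_smul]
            exact hx h _ }
      map_d := by
        rintro i j _ ⟨x, hx, rfl⟩ q hq l
        by_cases hij : j + 1 = i
        · rw [t.tm_d (disc S n) hq (q' := q - 1) (by lia) hij]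
          exact hx _ _
        · rw [(disc S n).shape i j hij]
          change t.tm (disc S n) hq 0 l ∈ K
          rw [map_zero]
          exact zero_mem K }
  have hgen : discGen S n ∈ C.carrier n := fun {q'} hq l => by
    obtain rfl : q' = q := by lia
    exact ⟨l, rfl⟩
  have hK : K = ⊤ := t.span _ K fun {p q} h x l => by
    have hx : x ∈ C.carrier p := by
      rw [C.eq_top_of_discGen_mem hgen p]
      exact Submodule.mem_top
    exact hx h l
  exact (hK ▸ AddSubgroup.mem_top z : z ∈ K)

/-- Evaluating `g` at the generator and writing `z` as generator ⊗ `l` turns the pairing into `c.ev`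
in degrees `n - m` and `m - n`. -/
lemma pair_disc_bijective (hc : ∀ {p q : ℤ} (h : p + q = 0), Function.Bijective (c.ev h))
    (n m : ℤ) : Function.Bijective (t.pair c (disc S n) m) := by
  have hnm : n + (m - n) = m := by lia
  constructor
  · refine (injective_iff_map_eq_zero _).2 fun g hg => (discEquiv n _).map_eq_zero_iff.1 ?_
    refine (hc (p := n - m) (q := m - n) (by lia)).1 ?_
    refine (AddMonoidHom.ext fun l => ?_).trans (map_zero _).symm
    exact (t.pair_tm c g hnm (discGen S n) l).symm.trans (DFunLike.congr_fun hg _)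
  · intro χ
    obtain ⟨a, ha⟩ := (hc (p := n - m) (q := m - n) (by lia)).2
      (χ.comp (t.tm (disc S n) hnm (discGen S n)))
    obtain ⟨g, rfl⟩ := (discEquiv n ((shiftCh m).obj A)).surjective a
    refine ⟨g, AddMonoidHom.ext fun z => ?_⟩
    obtain ⟨l, rfl⟩ := t.tm_discGen_surjective n hnm z
    exact (t.pair_tm c g hnm (discGen S n) l).trans (DFunLike.congr_fun ha l)

lemma flip_pair_disc_bijective
    (hc : ∀ {p q : ℤ} (h : p + q = 0), Function.Bijective (c.ev h).flip) (n m : ℤ) :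
    Function.Bijective (t.pair c (disc S n) m).flip := by
  have hnm : n + (m - n) = m := by lia
  constructor
  · refine (injective_iff_map_eq_zero _).2 fun z hz => ?_
    obtain ⟨l, rfl⟩ := t.tm_discGen_surjective n hnm z
    suffices l = 0 by rw [this, map_zero]
    refine (hc (p := n - m) (q := m - n) (by lia)).1 ?_
    refine (AddMonoidHom.ext fun a => ?_).trans (map_zero _).symm
    obtain ⟨g, rfl⟩ := (discEquiv n ((shiftCh m).obj A)).surjective a
    exact (t.pair_tm c g hnm (discGen S n) l).symm.trans (DFunLike.congr_fun hz g)
  · intro χ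
    obtain ⟨l, hl⟩ := (hc (p := n - m) (q := m - n) (by lia)).2
      (χ.comp (discEquiv n ((shiftCh m).obj A)).symm.toAddMonoidHom)
    refine ⟨t.tm (disc S n) hnm (discGen S n) l, AddMonoidHom.ext fun g => ?_⟩
    refine (t.pair_tm c g hnm (discGen S n) l).trans
      ((DFunLike.congr_fun hl (discEquiv n _ g)).trans ?_)
    exact congrArg χ ((discEquiv n _).symm_apply_apply g)

section DualBasis

variable {J : Type u} [Fintype J] {P : Ch.{u} S} {n : J → ℤ}
  {a : ∀ j, P ⟶ disc S (n j)} {b : ∀ j, disc S (n j) ⟶ P}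

lemma sum_map_map [F.Additive] (hab : ∑ j, a j ≫ b j = 𝟙 P) {m : ℤ} (z : (F.obj P).X m) :
    ∑ j, ((F.map (b j)).f m).hom (((F.map (a j)).f m).hom z) = z := by
  have h : ∑ j, F.map (a j) ≫ F.map (b j) = 𝟙 (F.obj P) := by
    rw [← F.map_id, ← hab, F.map_sum]
    simp only [F.map_comp]
  let φ : (F.obj P ⟶ F.obj P) →+ (F.obj P).X m :=
    AddMonoidHom.mk' (fun f => (f.f m).hom z) fun _ _ => rfl
  have h' := congrArg φ h
  rw [map_sum] at h'
  exact h'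

lemma sum_comp_comp (hab : ∑ j, a j ≫ b j = 𝟙 P) {Y : Ch.{u} S} (g : P ⟶ Y) :
    ∑ j, a j ≫ b j ≫ g = g := by
  have := congrArg (fun f => f ≫ g) hab
  simpa only [Preadditive.sum_comp, Category.assoc, Category.id_comp] using this

/-- By naturality the pairing of `P` is a retract of a finite sum of pairings of discs: restrict
along the `b j`, reassemble along the `a j`. -/
lemma pair_bijective_of_dualBasis [F.Additive] (hab : ∑ j, a j ≫ b j = 𝟙 P) {m : ℤ}
    (hb : ∀ j, Function.Bijective (t.pair c (disc S (n j)) m)) :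
    Function.Bijective (t.pair c P m) := by
  constructor
  · refine (injective_iff_map_eq_zero _).2 fun g hg => ?_
    have (j : J) : b j ≫ g = 0 := (hb j).1 (AddMonoidHom.ext fun z => by
      rw [pair_comp, hg, map_zero]; rfl)
    rw [← sum_comp_comp hab g]
    exact Finset.sum_eq_zero fun j _ => by rw [this, comp_zero]
  · intro χ
    choose g hg using fun j => (hb j).2 (χ.comp ((F.map (b j)).f m).hom)
    refine ⟨∑ j, a j ≫ g j, AddMonoidHom.ext fun z => ?_⟩
    rw [map_sum, AddMonoidHom.finsetSum_apply]
    conv_rhs => rw [← sum_map_map hab z, map_sum]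
    refine Finset.sum_congr rfl fun j _ => ?_
    rw [pair_comp, hg]
    rfl

lemma flip_pair_bijective_of_dualBasis [F.Additive] (hab : ∑ j, a j ≫ b j = 𝟙 P) {m : ℤ}
    (hb : ∀ j, Function.Bijective (t.pair c (disc S (n j)) m).flip) :
    Function.Bijective (t.pair c P m).flip := by
  constructor
  · refine (injective_iff_map_eq_zero _).2 fun z hz => ?_
    have (j : J) : ((F.map (a j)).f m).hom z = 0 := (hb j).1 (AddMonoidHom.ext fun g => by
      rw [map_zero, AddMonoidHom.flip_apply, ← pair_comp]
      exact DFunLike.congr_fun hz _)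
    rw [← sum_map_map hab z]
    exact Finset.sum_eq_zero fun j _ => by rw [this, map_zero]
  · intro χ
    choose z hz using fun j => (hb j).2 (χ.comp (precomp (a j) _))
    refine ⟨∑ j, ((F.map (b j)).f m).hom (z j), AddMonoidHom.ext fun g => ?_⟩
    rw [AddMonoidHom.flip_apply, map_sum]
    conv_rhs => rw [← sum_comp_comp hab g, map_sum]
    refine Finset.sum_congr rfl fun j _ => ?_
    rw [← pair_comp]
    exact DFunLike.congr_fun (hz j) (b j ≫ g)

end DualBasis

/-- If `A` is the character dual of `L` or conversely, then the first left derived functor of the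
modified tensor product with `L` vanishes on all complexes of type `FP_∞` if and only if `A` is
absolutely clean. -/
theorem forall_isZero_leftDerived_iff [F.Additive] (t : BarTensor σ F L)
    (c : CharPairing σ A L)
    (hc : (∀ {p q : ℤ} (h : p + q = 0), Function.Bijective (c.ev h)) ∨
      (∀ {p q : ℤ} (h : p + q = 0), Function.Bijective (c.ev h).flip)) :
    (∀ X : Ch.{u} S, IsFPInfty X → IsZero ((F.leftDerived 1).obj X)) ↔ IsAbsClean A := by
  have key {X : Ch.{u} S} (P : ProjectiveResolution X) (hP : ∀ n, IsFG (P.complex.X n)) (m : ℤ) :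
      Function.Exact ((F.map (P.complex.d 2 1)).f m).hom ((F.map (P.complex.d 1 0)).f m).hom ↔
        Subsingleton (Abelian.Ext.{u} X ((shiftCh m).obj A) 1) := by
    rw [subsingleton_ext_one_iff P]
    rcases hc with hc | hc
    · have hb (n : ℕ) : Function.Bijective (t.pair c (P.complex.X n) m) := by
        obtain ⟨J, _, n, a, b, hab⟩ := (hP n).exists_dualBasis
        exact t.pair_bijective_of_dualBasis c hab fun j => t.pair_disc_bijective c hc _ _
      exact exact_iff_exact_of_perfect (hb 0) (hb 1) (hb 2) (fun g z => t.pair_comp c _ g z)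
        (fun g z => t.pair_comp c _ g z)
    -- Here the tensor products are the duals of the Hom groups, so the duality of exact sequences
    -- is used with the two sides exchanged.
    · have hb (n : ℕ) : Function.Bijective (t.pair c (P.complex.X n) m).flip := by
        obtain ⟨J, _, n, a, b, hab⟩ := (hP n).exists_dualBasis
        exact t.flip_pair_bijective_of_dualBasis c hab fun j => t.flip_pair_disc_bijective c hc _ _
      have hadj (i j : ℕ) (z : (F.obj (P.complex.X i)).X m) (g : P.complex.X j ⟶ _) :
          (t.pair c (P.complex.X j) m).flip (((F.map (P.complex.d i j)).f m).hom z) g =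
            (t.pair c (P.complex.X i) m).flip z (precomp (P.complex.d i j) _ g) :=
        (t.pair_comp c (P.complex.d i j) g z).symm
      exact (exact_iff_exact_of_perfect (hb 2) (hb 1) (hb 0) (hadj 2 1) (hadj 1 0)).symm
  constructor
  · intro H
    -- Degree `0` suffices in this direction; the translate by `0` still has to be compared with
    -- `A`.
    have h0 : IsAbsClean ((shiftCh 0).obj A) := fun X hX => by
      have hX' := hX
      obtain ⟨P, hP⟩ := hX
      exact (key P hP 0).1 ((isZero_leftDerived_one_iff F P).1 (H X hX') 0)
    exact IsAbsClean.of_shiftCh 0 h0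
  · rintro H X hX
    have hX' := hX
    obtain ⟨P, hP⟩ := hX
    -- Every degree `m` is needed now, and is supplied by translation invariance.
    exact (isZero_leftDerived_one_iff F P).2 fun m => (key P hP m).2 (H.shiftCh m X hX')

end BarTensor

end Perfect

/-! ### Generators and relations of the modified tensor product. -/

section TensorBar

variable (R : Type u) [Ring R]

lemma tmul_balanced {M N : Type u} [AddCommGroup M] [AddCommGroup N] [Module Rᵐᵒᵖ M] [Module R N]
    (m : M) (r : R) (n : N) : tmul R (MulOpposite.op r • m) n = tmul R m (r • n) :=
  (QuotientAddGroup.eq_iff_sub_mem).2 (AddSubgroup.subset_closure ⟨m, r, n, rfl⟩)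

/-- The homomorphism on `M ⊗_R N` induced by a balanced biadditive map. -/
noncomputable def tensLift {M N : Type u} {A : Type*} [AddCommGroup M] [AddCommGroup N]
    [Module Rᵐᵒᵖ M] [Module R N] [AddCommGroup A] (β : M →+ N →+ A)
    (hβ : ∀ m (r : R) n, β (MulOpposite.op r • m) n = β m (r • n)) : Tens R M N →+ A :=
  QuotientAddGroup.lift _ (TensorProduct.liftAddHom β fun r m n => by
    rw [map_zsmul, map_zsmul]; rfl) (by
      rw [balancedSubgroup, AddSubgroup.closure_le]
      rintro _ ⟨m, r, n, rfl⟩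
      simp [hβ])

variable (X : Ch.{u} Rᵐᵒᵖ) (Y : Ch.{u} R)

/-- The canonical map `X_p ⊗ Y_q → (X ⊗̄ Y)_m` for `p + q = m`. -/
noncomputable def barι {p q m : ℤ} (h : p + q = m) :
    ((tensFunctor R).obj (X.X p)).obj (Y.X q) ⟶ (tensorCx R X Y).opcycles m :=
  HomologicalComplex.ιMapBifunctor X Y (tensFunctor R) (ComplexShape.down ℤ) p q m h ≫
    (tensorCx R X Y).pOpcycles m

/-- The class of `x ⊗ y` in `(X ⊗̄ Y)_m`. -/
noncomputable def barMk {p q m : ℤ} (h : p + q = m) :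
    X.X p →+ Y.X q →+ (tensorBar R X Y).X m :=
  AddMonoidHom.mk' (fun x => AddMonoidHom.mk' (fun y => (barι R X Y h).hom (tmul R x y))
    fun y y' => (congrArg (barι R X Y h).hom (tmul_add_right R x y y')).trans (map_add _ _ _))
    fun x x' => AddMonoidHom.ext fun y =>
      (congrArg (barι R X Y h).hom (tmul_add_left R x x' y)).trans (map_add _ _ _)

lemma barMk_balanced {p q m : ℤ} (h : p + q = m) (r : R) (x : X.X p) (y : Y.X q) :
    barMk R X Y h (MulOpposite.op r • x) y = barMk R X Y h x (r • y) :=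
  congrArg (barι R X Y h).hom (tmul_balanced R x r y)

lemma barMk_map {X X' : Ch.{u} Rᵐᵒᵖ} {Y Y' : Ch.{u} R} (f : X ⟶ X') (g : Y ⟶ Y') {p q m : ℤ}
    (h : p + q = m) (x : X.X p) (y : Y.X q) :
    ((tensorBarMap R f g).f m).hom (barMk R X Y h x y) =
      barMk R X' Y' h ((f.f p).hom x) ((g.f q).hom y) := by
  have H : barι R X Y h ≫ HomologicalComplex.opcyclesMap (tensorCxMap R f g) m =
      ((tensFunctor R).map (f.f p)).app (Y.X q) ≫ ((tensFunctor R).obj (X'.X p)).map (g.f q) ≫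
        barι R X' Y' h := by
    rw [barι, barι, Category.assoc, HomologicalComplex.p_opcyclesMap,
      HomologicalComplex.ι_mapBifunctorMap_assoc]
  exact congrArg (fun φ => φ.hom (tmul R x y)) H

/-- The differential of `X ⊗ Y` on `X_p ⊗ Y_q`. -/
lemma ι_tensorCx_d {p p' q q' m n : ℤ} (h : p + q = m) (h₁ : p' + q = n) (h₂ : p + q' = n)
    (hp : p' + 1 = p) (hq : q' + 1 = q) :
    HomologicalComplex.ιMapBifunctor X Y (tensFunctor R) (ComplexShape.down ℤ) p q m h ≫
        (tensorCx R X Y).d m n =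
      ((tensFunctor R).map (X.d p p')).app (Y.X q) ≫
        HomologicalComplex.ιMapBifunctor X Y (tensFunctor R) (ComplexShape.down ℤ) p' q n h₁ +
      p.negOnePow • (((tensFunctor R).obj (X.X p)).map (Y.d q q') ≫
        HomologicalComplex.ιMapBifunctor X Y (tensFunctor R) (ComplexShape.down ℤ) p q' n h₂) := by
  rw [HomologicalComplex.mapBifunctor.d_eq, Preadditive.comp_add,
    HomologicalComplex.mapBifunctor.ι_D₁, HomologicalComplex.mapBifunctor.ι_D₂,
    HomologicalComplex.mapBifunctor.d₁_eq X Y (tensFunctor R) _ hp q n h₁,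
    HomologicalComplex.mapBifunctor.d₂_eq X Y (tensFunctor R) _ p hq n h₂]
  congr 1
  -- The sign attached to the first partial differential is `1`.
  exact one_smul _ _

/-- The left side is the class of the boundary `d (x ⊗ y)`. -/
lemma barMk_d {p p' q q' n : ℤ} (h₁ : p' + q = n) (h₂ : p + q' = n)
    (hp : p' + 1 = p) (x : X.X p) (y : Y.X q) :
    barMk R X Y h₁ ((X.d p p').hom x) y +
      p.negOnePow • barMk R X Y h₂ x ((Y.d q q').hom y) = 0 := by
  have H := congrArg (fun f => f ≫ (tensorCx R X Y).pOpcycles n)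
    (ι_tensorCx_d R X Y (rfl : p + q = p + q) h₁ h₂ hp (by lia))
  beta_reduce at H
  rw [Category.assoc, HomologicalComplex.d_pOpcycles, comp_zero, Preadditive.add_comp,
    Linear.units_smul_comp, Category.assoc, Category.assoc] at H
  exact (congrArg (fun φ => φ.hom (tmul R x y)) H).symm

lemma bar_hom_ext {m : ℤ} {A : AddCommGrpCat.{u}} {f g : (tensorCx R X Y).opcycles m ⟶ A}
    (H : ∀ {p q : ℤ} (h : p + q = m), barι R X Y h ≫ f = barι R X Y h ≫ g) : f = g := by
  rw [← cancel_epi ((tensorCx R X Y).pOpcycles m)]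
  apply HomologicalComplex.mapBifunctor.hom_ext
  intro p q h
  simpa only [barι, Category.assoc] using H h

/-- The projection modulo `K` kills all generators, so it is zero. -/
lemma bar_span {m : ℤ} (K : AddSubgroup ((tensorBar R X Y).X m))
    (hK : ∀ {p q : ℤ} (h : p + q = m) (x : X.X p) (y : Y.X q), barMk R X Y h x y ∈ K) :
    K = ⊤ := by
  have H : AddCommGrpCat.ofHom (QuotientAddGroup.mk' K) = 0 := bar_hom_ext R X Y fun {p q} h => by
    refine AddCommGrpCat.hom_ext (tens_hom_ext R fun x y => ?_)
    exact (QuotientAddGroup.eq_zero_iff _).2 (hK h x y)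
  refine eq_top_iff.2 fun z _ => (QuotientAddGroup.eq_zero_iff z).1 ?_
  exact congrArg (fun φ => φ.hom z) H

/-- By `hs` the forms define a map on the direct sum of the `X_p ⊗ Y_q`; by `hd` it kills
boundaries. -/
lemma bar_lift {m : ℤ} (β : ∀ {p q : ℤ}, p + q = m → (X.X p →+ Y.X q →+ AddCircle (1 : ℚ)))
    (hs : ∀ {p q : ℤ} (h : p + q = m) (x : X.X p) (r : R) (y : Y.X q),
      β h (MulOpposite.op r • x) y = β h x (r • y))
    (hd : ∀ {p p' q q' : ℤ} (h₁ : p' + q = m) (h₂ : p + q' = m) (_ : p' + 1 = p)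
      (x : X.X p) (y : Y.X q),
      β h₁ ((X.d p p').hom x) y + p.negOnePow • β h₂ x ((Y.d q q').hom y) = 0) :
    ∃ χ : (tensorBar R X Y).X m →+ AddCircle (1 : ℚ),
      ∀ {p q : ℤ} (h : p + q = m) (x : X.X p) (y : Y.X q), χ (barMk R X Y h x y) = β h x y := by
  -- ℚ/ℤ is lifted to universe `u` to become an object of the target category.
  let A : AddCommGrpCat.{u} := AddCommGrpCat.of (ULift.{u} (AddCircle (1 : ℚ)))
  let up : AddCircle (1 : ℚ) →+ A := AddEquiv.ulift.symm.toAddMonoidHom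
  let down : A →+ AddCircle (1 : ℚ) := AddEquiv.ulift.toAddMonoidHom
  let b {p q : ℤ} (h : p + q = m) : ((tensFunctor R).obj (X.X p)).obj (Y.X q) ⟶ A :=
    AddCommGrpCat.ofHom (up.comp (tensLift R (β h) (hs h)))
  let φ : (tensorCx R X Y).X m ⟶ A := HomologicalComplex.mapBifunctorDesc fun p q h => b h
  have hφ {p q : ℤ} (h : p + q = m) :
      HomologicalComplex.ιMapBifunctor X Y (tensFunctor R) (ComplexShape.down ℤ) p q m h ≫ φ =
        b h := HomologicalComplex.ι_mapBifunctorDesc _ _ _ _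
  have hdφ : (tensorCx R X Y).d (m + 1) m ≫ φ = 0 := by
    apply HomologicalComplex.mapBifunctor.hom_ext
    intro p q h
    have h' : p + q = m + 1 := h
    rw [← Category.assoc, ι_tensorCx_d R X Y h (p' := p - 1) (q' := q - 1) (n := m) (by lia)
      (by lia) (by lia) (by lia), Preadditive.add_comp, Category.assoc, Linear.units_smul_comp,
      Category.assoc, hφ, hφ, comp_zero]
    refine AddCommGrpCat.hom_ext (tens_hom_ext R fun x y => ?_)
    have := congrArg up (hd (p := p) (p' := p - 1) (q := q) (q' := q - 1) (by lia)
      (by lia) (by lia) x y)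
    rw [map_zero] at this
    exact this
  let χ : (tensorCx R X Y).opcycles m ⟶ A :=
    (tensorCx R X Y).descOpcycles φ (m + 1) (by simp) hdφ
  refine ⟨down.comp χ.hom, fun {p q} h x y => ?_⟩
  have : barι R X Y h ≫ χ = b h := by
    rw [barι, Category.assoc, HomologicalComplex.p_descOpcycles, hφ]
  exact congrArg (fun f => down (f.hom (tmul R x y))) this

end TensorBar

/-! ### Removal of signs, and the evaluation pairings. -/

section Instances

/-- The sign `(-1)^(p (p - 1) / 2)`. -/
def triangleSign (p : ℤ) : ℤˣ := (p * (p - 1) / 2).negOnePow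

lemma triangleSign_succ (p : ℤ) : triangleSign (p + 1) = triangleSign p * p.negOnePow := by
  rw [triangleSign, triangleSign, ← Int.negOnePow_add]
  congr 1
  rw [show (p + 1) * (p + 1 - 1) = p * (p - 1) + p * 2 by ring,
    Int.add_mul_ediv_right _ _ (by norm_num)]

/-- The recurrence of `triangleSign` is chosen to absorb the sign: the relation `dx ⊗ y = -(-1)^p x
⊗ dy` becomes `dx ⊗ y = x ⊗ dy` after rescaling. -/
lemma smul_eq_smul_of_add_negOnePow_smul_eq_zero {G : Type*} [AddCommGroup G] {p p' : ℤ}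
    (hp : p' + 1 = p) {a b : G} (h : a + p.negOnePow • b = 0) :
    triangleSign p' • a = triangleSign p • b := by
  subst hp
  rw [triangleSign_succ, mul_smul, eq_neg_of_add_eq_zero_left h, Int.negOnePow_succ,
    Units.neg_smul, neg_neg]

lemma triangleSign_smul_smul {G : Type*} [AddCommGroup G] (p : ℤ) (a : G) :
    triangleSign p • triangleSign p • a = a := by
  rw [smul_smul, Int.units_mul_self, one_smul]

lemma map_units_smul {G H : Type*} [AddCommGroup G] [AddCommGroup H] (f : G →+ H) (e : ℤˣ)
    (a : G) : f (e • a) = e • f a :=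
  map_zsmul f (e : ℤ) a

variable (R : Type u) [Ring R]

/-- The generators of `X ⊗̄ Y`, as a functor of `X`. -/
noncomputable def barTensorLeft (Y : Ch.{u} R) :
    BarTensor (MulOpposite.unop : Rᵐᵒᵖ → R) (tensorBarLeft R Y) Y where
  tm X {p q m} h := triangleSign p • barMk R X Y h
  map_tm {X X'} f {p q m} h x l :=
    (map_units_smul ((tensorBarMap R f (𝟙 Y)).f m).hom _ _).trans
      (congrArg (triangleSign p • ·) (barMk_map R f (𝟙 Y) h x l))
  tm_smul X {p q m} h s x l :=
    congrArg (triangleSign p • ·) (barMk_balanced R X Y h s.unop x l)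
  tm_d X {p p' q q' m} h h' hp x l :=
    smul_eq_smul_of_add_negOnePow_smul_eq_zero hp (barMk_d R X Y h h' hp x l)
  lift X {m} β hs hd := by
    obtain ⟨χ, hχ⟩ := bar_lift R X Y (fun {p q} h => triangleSign p • β h)
      (fun {p q} h x r y => congrArg (triangleSign p • ·) (hs h (MulOpposite.op r) x y))
      (fun {p p' q q'} h h' hp x y => by
        subst hp
        change triangleSign p' • β h _ y +
          (p' + 1).negOnePow • triangleSign (p' + 1) • β h' x _ = 0
        rw [hd h h' rfl, triangleSign_succ, Int.negOnePow_succ, Units.neg_smul, smul_smul,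
          mul_comm, mul_assoc, Int.units_mul_self, mul_one, add_neg_cancel])
    refine ⟨χ, fun {p q} h x l => ?_⟩
    refine (map_units_smul χ _ _).trans ((congrArg (triangleSign p • ·) (hχ h x l)).trans ?_)
    exact triangleSign_smul_smul p _
  span X {m} K hK := bar_span R X Y K fun {p q} h x y => by
    rw [← triangleSign_smul_smul p (barMk R X Y h x y)]
    exact zsmul_mem (hK h x y) _

/-- The generators of `X ⊗̄ Y`, as a functor of `Y`. -/
noncomputable def barTensorRight (X : Ch.{u} Rᵐᵒᵖ) :
    BarTensor (MulOpposite.op : R → Rᵐᵒᵖ) (tensorBarRight R X) X where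
  -- The sign still follows the degree of the factor in `X`, which here is `q`.
  tm Y {p q m} h := triangleSign q • (barMk R X Y ((add_comm q p).trans h)).flip
  map_tm {Y Y'} f {p q m} h y x :=
    (map_units_smul ((tensorBarMap R (𝟙 X) f).f m).hom _ _).trans
      (congrArg (triangleSign q • ·) (barMk_map R (𝟙 X) f _ x y))
  tm_smul Y {p q m} h s y x :=
    congrArg (triangleSign q • ·) (barMk_balanced R X Y _ s x y).symm
  tm_d Y {p p' q q' m} h h' hp y x :=
    (smul_eq_smul_of_add_negOnePow_smul_eq_zero (by lia)
      (barMk_d R X Y (by lia) (by lia) (by lia) x y)).symm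
  lift Y {m} β hs hd := by
    obtain ⟨χ, hχ⟩ := bar_lift R X Y
      (fun {q p} h => triangleSign q • (β ((add_comm p q).trans h)).flip)
      (fun {q p} h x r y => congrArg (triangleSign q • ·) (hs _ r y x).symm)
      (fun {q q' p p'} h h' hq x y => by
        subst hq
        change triangleSign q' • β _ y _ +
          (q' + 1).negOnePow • triangleSign (q' + 1) • β _ _ x = 0
        rw [hd (q' := q') ((add_comm _ _).trans h') ((add_comm _ _).trans h) (by lia),
          triangleSign_succ, Int.negOnePow_succ, Units.neg_smul, smul_smul,
          mul_comm, mul_assoc, Int.units_mul_self, mul_one, add_neg_cancel])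
    refine ⟨χ, fun {p q} h y x => ?_⟩
    refine (map_units_smul χ _ _).trans ((congrArg (triangleSign q • ·)
      (hχ ((add_comm q p).trans h) x y)).trans ?_)
    exact triangleSign_smul_smul q _
  span Y {m} K hK := bar_span R X Y K fun {q p} h x y => by
    rw [← triangleSign_smul_smul q (barMk R X Y h x y)]
    exact zsmul_mem (hK ((add_comm p q).trans h) y x) _

/-- Interchange of the two complexes of a pairing. -/
def CharPairing.flip {S T : Type u} [Ring S] [Ring T] {σ : S → T} {A : Ch.{u} S} {L : Ch.{u} T}
    (c : CharPairing σ A L) (τ : T → S) (hτ : ∀ t, σ (τ t) = t) : CharPairing τ L A where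
  ev {p q} h := (c.ev ((add_comm q p).trans h)).flip
  ev_smul h t l a := ((c.ev_smul _ (τ t) a l).trans
    (congrArg (fun s => c.ev _ a (s • l)) (hτ t))).symm
  ev_d h h' hp l a := (c.ev_d _ _ (by lia) a l).symm

variable {R}

/-- The evaluation pairing of `L^+` and `L`, for a complex `L` of left modules. -/
def charPairingOfLeft (L : Ch.{u} R) :
    CharPairing (MulOpposite.unop : Rᵐᵒᵖ → R) (charCxOfLeft L) L where
  -- The degrees `q` and `-p` are only propositionally equal, hence the transport.
  ev {p q} h := AddMonoidHom.compHom'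
    (L.XIsoOfEq (show q = -p by lia)).hom.hom.toAddMonoidHom
  ev_smul {p q} h s φ l := by
    obtain rfl : q = -p := by lia
    rfl
  ev_d {p p' q q'} h h' hp φ l := by
    obtain rfl : q = -p' := by lia
    obtain rfl : q' = -p := by lia
    rfl

lemma charPairingOfLeft_bijective (L : Ch.{u} R) {p q : ℤ} (h : p + q = 0) :
    Function.Bijective ((charPairingOfLeft L).ev h) := by
  obtain rfl : q = -p := by lia
  exact Function.bijective_id

/-- The evaluation pairing of `L^+` and `L`, for a complex `L` of right modules. -/
def charPairingOfRight (L : Ch.{u} Rᵐᵒᵖ) :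
    CharPairing (MulOpposite.op : R → Rᵐᵒᵖ) (charCxOfRight L) L where
  ev {p q} h := AddMonoidHom.compHom'
    (L.XIsoOfEq (show q = -p by lia)).hom.hom.toAddMonoidHom
  ev_smul {p q} h s φ l := by
    obtain rfl : q = -p := by lia
    rfl
  ev_d {p p' q q'} h h' hp φ l := by
    obtain rfl : q = -p' := by lia
    obtain rfl : q' = -p := by lia
    rfl

lemma charPairingOfRight_bijective (L : Ch.{u} Rᵐᵒᵖ) {p q : ℤ} (h : p + q = 0) :
    Function.Bijective ((charPairingOfRight L).ev h) := by
  obtain rfl : q = -p := by lia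
  exact Function.bijective_id

end Instances

end ACComplex

theorem mainTheorem6 (R : Type u) [Ring R] :
    (∀ L : ACComplex.Ch.{u} R,
      ACComplex.IsLevelLeft L ↔ ACComplex.IsAbsClean (ACComplex.charCxOfLeft L)) ∧
    (∀ L : ACComplex.Ch.{u} Rᵐᵒᵖ,
      ACComplex.IsLevelRight L ↔ ACComplex.IsAbsClean (ACComplex.charCxOfRight L)) ∧
    (∀ A : ACComplex.Ch.{u} R,
      ACComplex.IsAbsClean A ↔ ACComplex.IsLevelRight (ACComplex.charCxOfLeft A)) ∧
    (∀ A : ACComplex.Ch.{u} Rᵐᵒᵖ,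
      ACComplex.IsAbsClean A ↔ ACComplex.IsLevelLeft (ACComplex.charCxOfRight A)) := by
  refine ⟨fun L => ?_, fun L => ?_, fun A => ?_, fun A => ?_⟩
  · exact (ACComplex.barTensorLeft R L).forall_isZero_leftDerived_iff
      (ACComplex.charPairingOfLeft L) (Or.inl (ACComplex.charPairingOfLeft_bijective L))
  · exact (ACComplex.barTensorRight R L).forall_isZero_leftDerived_iff
      (ACComplex.charPairingOfRight L) (Or.inl (ACComplex.charPairingOfRight_bijective L))
  -- Now the tensor factor is the character complex, so the evaluation pairing enters flipped and
  -- the second alternative of the duality applies.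
  · exact ((ACComplex.barTensorRight R (ACComplex.charCxOfLeft A)).forall_isZero_leftDerived_iff
      ((ACComplex.charPairingOfLeft A).flip MulOpposite.op fun _ => rfl)
      (Or.inr fun {p q} h =>
        ACComplex.charPairingOfLeft_bijective A ((add_comm q p).trans h))).symm
  · exact ((ACComplex.barTensorLeft R (ACComplex.charCxOfRight A)).forall_isZero_leftDerived_iff
      ((ACComplex.charPairingOfRight A).flip MulOpposite.unop fun _ => rfl)
      (Or.inr fun {p q} h =>
        ACComplex.charPairingOfRight_bijective A ((add_comm q p).trans h))).symm
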